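/- **Setting.** Let $T_n$ ($n\ge 1$) be the edge-rooted binary tree: a root with exactly one child, whose subtree is a complete binary tree with $n$ levels counted in vertices (so $T_n$ has $2^{n-1}$ leaves, all at depth $n$). An edge $e$ has depth $d$ if the path starting with $e$ and ending at the root has $d$ edges. Fix $0<a<b$. Let the edge weights $X_e$ be independent, identically distributed random variables with values in $[a,b]$, with mean $\mu=\mathbf{E}X_e$ and variance $\sigma^2=\mathbf{Var}[X_e]$, and let an edge $e$ of depth $d$ have resistance $r_e=2^{d-1}X_e$. Let $U$ be the voltage on the vertices of $T_n$ that equals $1$ at the root and $0$ at the leaves and for which the currents $i(u,v)=(U(u)-U(v))/r_{uv}$ satisfy $\sum_{v\sim u}i(u,v)=0$ at every other vertex $u$. The effective conductance $C_n$ of $T_n$ between the root and the leaves is the total current $\sum_{v\sim \mathrm{root}} i(\mathrm{root},v)$ flowing out of the root, and the effective resistance is $R_n=1/C_n$. **Theorem.** For all $0<a<b$ there exist constants $M_1$ and $M_2$, depending only on $a$ and $b$, such that for every choice of i.i.d. edge weights with values in $[a,b]$, with mean $\mu$ and variance $\sigma^2$, and for all integers $n\ge 2$, the random variables $R_n$ and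 $C_n$ are integrable and $$\left|\mathbf{E}R_n-\mu n+\frac{\sigma^2}{\mu}\ln n\right|\le M_1\qquad\text{and}\qquad\left|\mathbf{E}C_n-\frac{1}{\mu n}-\frac{\sigma^2\ln n}{\mu^3n^2}\right|\le\frac{M_2}{n^2}.$$ -/

import Mathlib

open MeasureTheory ProbabilityTheory

noncomputable section

namespace ElectricNetwork

/-! ### Finite electric networks -/

/-- The current from `u` to `v` determined by Ohm's law `i(u, v) * r_e = U(u) - U(v)`, where
`e = s(u, v)` is an edge of resistance `r e > 0` and `U` is the voltage. -/
def current {V : Type*} (r : Sym2 V → ℝ) (U : V → ℝ) (u v : V) : ℝ :=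
  (U u - U v) / r s(u, v)

open Classical in
/-- `U` is the voltage on the network `(G, r)` with value `1` on `A` and `0` on `B`: off `A ∪ B`,
the currents given by Ohm's law satisfy Kirchhoff's node law. -/
structure IsVoltage {V : Type*} [Fintype V] (G : SimpleGraph V) (r : Sym2 V → ℝ)
    (A B : Finset V) (U : V → ℝ) : Prop where
  eq_one : ∀ u ∈ A, U u = 1
  eq_zero : ∀ v ∈ B, U v = 0
  node_law : ∀ u, u ∉ A → u ∉ B → ∑ v with G.Adj u v, current r U u v = 0

open Classical in
/-- The effective conductance between `A` and `B`: the total current flowing into the network out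
of `A`, for the voltage that is `1` on `A` and `0` on `B`. (On a finite connected graph with
positive resistances, and `A`, `B` disjoint and nonempty, this voltage exists and is unique.) -/
def effectiveConductance {V : Type*} [Fintype V] (G : SimpleGraph V) (r : Sym2 V → ℝ)
    (A B : Finset V) : ℝ :=
  if h : ∃ U, IsVoltage G r A B U then
    ∑ u ∈ A, ∑ v with G.Adj u v, current r h.choose u v
  else 0

/-- The effective resistance between `A` and `B`. -/
def effectiveResistance {V : Type*} [Fintype V] (G : SimpleGraph V) (r : Sym2 V → ℝ)
    (A B : Finset V) : ℝ :=
  1 / effectiveConductance G r A B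

/-! ### The edge-rooted binary tree `T_n` -/

/-- Nodes of the complete binary tree with `n` levels: binary words of length less than `n`. -/
abbrev Word (n : ℕ) : Type := {w : List Bool // w.length < n}

instance instFintypeWord (n : ℕ) : Fintype (Word n) :=
  (List.finite_length_lt Bool n).fintype

/-- Vertices of `T_n`: the root `none`, and a complete binary tree with `n` levels. -/
abbrev Vertex (n : ℕ) : Type := Option (Word n)

/-- `IsParent u v`: the vertex `v` is a child of `u`. The empty word is the only child of the
root, and the children of a word `w` are `w ++ [false]` and `w ++ [true]`. -/
def IsParent {n : ℕ} : Vertex n → Vertex n → Prop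
  | none, some w => w.1 = []
  | some v, some w => ∃ b : Bool, w.1 = v.1 ++ [b]
  | _, none => False

/-- The edge-rooted binary tree `T_n`. -/
def edgeRootedTree (n : ℕ) : SimpleGraph (Vertex n) := SimpleGraph.fromRel IsParent

/-- The depth of a vertex: the number of edges on its path to the root. -/
def depth {n : ℕ} : Vertex n → ℕ
  | none => 0
  | some w => w.1.length + 1

/-- The root, as a set of vertices. -/
def root (n : ℕ) : Finset (Vertex n) := {none}

/-- The leaves of `T_n`: the vertices at depth `n`. -/
def leaves (n : ℕ) : Finset (Vertex n) := {v | depth v = n}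

/-- The resistance of the edge from `v` to its parent. This edge has depth `d = depth v`, and its
resistance is `2 ^ (d - 1) * x e`; edges `e` are labelled by the word of their lower endpoint.
(The root has no parent; its value is not used.) -/
def parentEdgeResistance {n : ℕ} (x : List Bool → ℝ) : Vertex n → ℝ
  | none => 0
  | some w => 2 ^ (depth (some w) - 1) * x w.1

/-- The resistances of the edges of `T_n`, when the edges have weights `x`. The resistance of an
edge is found from its deeper endpoint. (Pairs of vertices of equal depth are not edges; their
value is not used.) -/
def treeResistance {n : ℕ} (x : List Bool → ℝ) : Sym2 (Vertex n) → ℝ :=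
  Sym2.lift ⟨fun u v =>
    if depth u < depth v then parentEdgeResistance x v
    else if depth v < depth u then parentEdgeResistance x u
    else 0, by
      intro u v
      dsimp only
      split_ifs <;> first | rfl | omega⟩

/-- The effective conductance `C_n` of `T_n` between the root and the leaves, when the edges have
weights `x`. -/
def treeConductance (n : ℕ) (x : List Bool → ℝ) : ℝ :=
  effectiveConductance (edgeRootedTree n) (treeResistance x) (root n) (leaves n)

/-- The effective resistance `R_n` of `T_n` between the root and the leaves, when the edges have
weights `x`. -/
def treeEffectiveResistance (n : ℕ) (x : List Bool → ℝ) : ℝ :=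
  effectiveResistance (edgeRootedTree n) (treeResistance x) (root n) (leaves n)

end ElectricNetwork

end

/-! ### The series-parallel recursion on weight functions. -/

namespace ElectricNetwork

/-! Resistances double with depth, so after rescaling, a tree consists of its root edge in series
with two parallel independent copies of a shorter tree. With `X` the root weight and `A` the average
of the two rescaled conductances, the new conductance is `1 / (X + 1 / A)`. `treeConductance_succ`
reduces the electrical problem to this recursion.

Write `N` for the number of levels; conductances have order `1 / N`. Averaging halves the variance,
the map `A ↦ A / (1 + X A)` is a contraction, and the fluctuation of `X` contributes `O(N⁻⁴)`; hence
the variance is `O(N⁻⁴)` (`le_div_pow_four_of_contraction`). In the mean, the term linear in `A - E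
A` vanishes by independence. A Taylor expansion in `X` then gives, for the mean `e` and `F = 1 / e +
μ`, the new mean `1 / F + σ² / F³ + O(N⁻⁴)` (`series_parallel_mean_variance`).

Passing to `f = 1 / e` turns this into `f ↦ f + μ - σ² / (f + μ) + O(N⁻²)`, whose solution is `μ N -
(σ² / μ) log N + O(1)` (`exists_abs_sub_add_log_le`). Inverting `f` gives the mean conductance
(`exists_abs_one_div_sub_le`). The mean resistance differs from `f` by at most a multiple of the
variance times `N³`, which is `O(1 / N)` (`abs_integral_one_div_sub_le`). -/

/-- The effective conductance of a rooted binary tree with `k + 1` levels of edges, computed by the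
series and parallel laws. -/
noncomputable def subtreeConductance : ℕ → (List Bool → ℝ) → ℝ
  | 0, x => 1 / x []
  | k + 1, x => 1 / (x [] + 2 / (subtreeConductance k (fun w => x (false :: w)) +
      subtreeConductance k (fun w => x (true :: w))))

lemma subtreeConductance_pos (k : ℕ) : ∀ x : List Bool → ℝ, (∀ w, 0 < x w) →
    0 < subtreeConductance k x := by
  induction k with
  | zero => intro x hx; simpa [subtreeConductance] using hx []
  | succ k ih =>
    intro x hx
    have h0 := ih (fun w => x (false :: w)) fun w => hx _
    have h1 := ih (fun w => x (true :: w)) fun w => hx _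
    have h2 := hx []
    rw [subtreeConductance]
    positivity

lemma subtreeConductance_succ_append (k : ℕ) (x : List Bool → ℝ) (w : List Bool) :
    subtreeConductance (k + 1) (fun v => x (w ++ v)) =
      1 / (x w + 2 / (subtreeConductance k (fun v => x ((w ++ [false]) ++ v)) +
        subtreeConductance k (fun v => x ((w ++ [true]) ++ v)))) := by
  simp [subtreeConductance]

/-- Rayleigh monotonicity: the extremes are the constant weights `b` and `a`, for which each of the
`k + 1` levels adds exactly one weight to the resistance. -/
lemma subtreeConductance_bounds {a b : ℝ} (ha : 0 < a) (hab : a ≤ b) (k : ℕ) :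
    ∀ x : List Bool → ℝ, (∀ w, x w ∈ Set.Icc a b) →
      1 / (b * (k + 1)) ≤ subtreeConductance k x ∧ subtreeConductance k x ≤ 1 / (a * (k + 1)) := by
  have hb : 0 < b := ha.trans_le hab
  induction k with
  | zero =>
    intro x hx
    have h := hx []
    have h0 : 0 < x [] := ha.trans_le h.1
    simp only [subtreeConductance, Nat.cast_zero, zero_add, mul_one]
    exact ⟨one_div_le_one_div_of_le h0 h.2, one_div_le_one_div_of_le ha h.1⟩
  | succ k ih =>
    intro x hx
    obtain ⟨l0, u0⟩ := ih (fun w => x (false :: w)) fun w => hx _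
    obtain ⟨l1, u1⟩ := ih (fun w => x (true :: w)) fun w => hx _
    have h := hx []
    have h0 : 0 < x [] := ha.trans_le h.1
    rw [subtreeConductance]
    set S := subtreeConductance k (fun w => x (false :: w)) +
      subtreeConductance k (fun w => x (true :: w)) with hS
    have hl : 0 < 1 / (b * ((k : ℝ) + 1)) := by positivity
    have hSpos : 0 < S := by linarith
    have e1 : 2 / S ≤ b * (k + 1) := by
      rw [div_le_iff₀ hSpos]
      have : b * ((k : ℝ) + 1) * (2 * (1 / (b * (k + 1)))) = 2 := by field_simp
      have h3 : b * ((k : ℝ) + 1) * (2 * (1 / (b * (k + 1)))) ≤ b * (k + 1) * S := by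
        gcongr; linarith
      linarith
    have e2 : a * (k + 1) ≤ 2 / S := by
      rw [le_div_iff₀ hSpos]
      have : a * ((k : ℝ) + 1) * (2 * (1 / (a * (k + 1)))) = 2 := by field_simp
      have h3 : a * ((k : ℝ) + 1) * S ≤ a * (k + 1) * (2 * (1 / (a * (k + 1)))) := by
        gcongr; linarith
      linarith
    have e3 : 0 < 2 / S := by positivity
    push_cast
    constructor
    · apply one_div_le_one_div_of_le (by positivity); linarith [h.2]
    · apply one_div_le_one_div_of_le (by positivity); linarith [h.1]

lemma measurable_subtreeConductance (k : ℕ) : Measurable (subtreeConductance k) := by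
  induction k with
  | zero =>
    have : subtreeConductance 0 = fun x => 1 / x [] := rfl
    rw [this]; fun_prop
  | succ k ih =>
    have : subtreeConductance (k + 1) = fun x => 1 / (x [] +
      2 / (subtreeConductance k (fun w => x (false :: w)) +
      subtreeConductance k (fun w => x (true :: w)))) := rfl
    rw [this]
    fun_prop

/-! ### Parents and children in the edge-rooted tree -/

section Tree

variable {n : ℕ}

lemma IsParent.depth_eq {u v : Vertex n} (h : IsParent u v) : depth v = depth u + 1 := by
  match u, v, h with
  | none, some w, h => have : w.1 = [] := h; simp [depth, this]
  | some u, some v, h => obtain ⟨b, hb⟩ := h; simp [depth, hb]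

lemma IsParent.unique {p q v : Vertex n} (hp : IsParent p v) (hq : IsParent q v) : p = q := by
  match p, q, v, hp, hq with
  | none, none, _, _, _ => rfl
  | none, some q, some w, hp, hq =>
    have h : w.1 = [] := hp
    obtain ⟨b, hb⟩ := hq
    simp [h] at hb
  | some p, none, some w, hp, hq =>
    have h : w.1 = [] := hq
    obtain ⟨b, hb⟩ := hp
    simp [h] at hb
  | some p, some q, some w, hp, hq =>
    obtain ⟨b, hb⟩ := hp
    obtain ⟨c, hc⟩ := hq
    rw [hb] at hc
    have := List.append_inj_left' hc rfl
    simpa [Subtype.ext_iff] using this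

lemma exists_isParent (w : Word n) : ∃ p : Vertex n, IsParent p (some w) := by
  obtain ⟨w, hw⟩ := w
  rcases List.eq_nil_or_concat w with h | ⟨u, c, h⟩
  · exact ⟨none, h⟩
  · rw [List.concat_eq_append] at h
    subst h
    refine ⟨some ⟨u, ?_⟩, c, rfl⟩
    simp at hw
    omega

/-- The child of a node in direction `c`. -/
def child (w : Word n) (h : w.1.length + 1 < n) (c : Bool) : Word n :=
  ⟨w.1 ++ [c], by simpa using h⟩

lemma isParent_child (w : Word n) (h : w.1.length + 1 < n) (c : Bool) :
    IsParent (some w) (some (child w h c)) := ⟨c, rfl⟩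

lemma edgeRootedTree_adj {u v : Vertex n} :
    (edgeRootedTree n).Adj u v ↔ IsParent u v ∨ IsParent v u := by
  rw [edgeRootedTree, SimpleGraph.fromRel_adj]
  refine ⟨fun h => h.2, fun h => ⟨?_, h⟩⟩
  rintro rfl
  rcases h with h | h <;> · have := h.depth_eq; omega

lemma mem_leaves {v : Vertex n} : v ∈ leaves n ↔ depth v = n := by
  rw [leaves, Finset.mem_filter_univ]

lemma some_mem_leaves {w : Word n} : some w ∈ leaves n ↔ w.1.length + 1 = n := mem_leaves

lemma sum_root (f : Vertex n → ℝ) : ∑ u ∈ root n, f u = f none := Finset.sum_singleton ..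

open Classical in
lemma sum_adj_root (hn : 0 < n) (f : Vertex n → ℝ) :
    ∑ v with (edgeRootedTree n).Adj none v, f v = f (some ⟨[], hn⟩) := by
  have : (Finset.univ.filter fun v => (edgeRootedTree n).Adj none v) = {some ⟨[], hn⟩} := by
    ext v
    simp only [Finset.mem_filter, Finset.mem_univ, true_and, Finset.mem_singleton,
      edgeRootedTree_adj]
    match v with
    | none => simp [IsParent]
    | some w => simp [IsParent, Subtype.ext_iff]
  rw [this, Finset.sum_singleton]

open Classical in
lemma sum_adj_node (w : Word n) (h : w.1.length + 1 < n) {p : Vertex n} (hp : IsParent p (some w))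
    (f : Vertex n → ℝ) :
    ∑ v with (edgeRootedTree n).Adj (some w) v, f v =
      f p + f (some (child w h false)) + f (some (child w h true)) := by
  have : (Finset.univ.filter fun v => (edgeRootedTree n).Adj (some w) v) =
      {p, some (child w h false), some (child w h true)} := by
    ext v
    simp only [Finset.mem_filter, Finset.mem_univ, true_and, Finset.mem_singleton,
      Finset.mem_insert, edgeRootedTree_adj]
    constructor
    · rintro (hv | hv)
      · match v, hv with
        | some v, ⟨c, hc⟩ =>
          right
          cases c
          · left; simp [child, Subtype.ext_iff, hc]
          · right; simp [child, Subtype.ext_iff, hc]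
      · exact Or.inl (hv.unique hp)
    · rintro (rfl | rfl | rfl)
      · exact Or.inr hp
      · exact Or.inl (isParent_child ..)
      · exact Or.inl (isParent_child ..)
  have hd := hp.depth_eq
  have h1 := (isParent_child w h false).depth_eq
  have h2 := (isParent_child w h true).depth_eq
  rw [this, Finset.sum_insert, Finset.sum_insert, Finset.sum_singleton, add_assoc]
  · simp [child]
  · simp only [Finset.mem_insert, Finset.mem_singleton, not_or]
    constructor <;> rintro rfl <;> omega

lemma treeResistance_of_isParent (x : List Bool → ℝ) {p : Vertex n} {w : Word n}
    (hp : IsParent p (some w)) : treeResistance x s(p, some w) = 2 ^ w.1.length * x w.1 := by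
  have := hp.depth_eq
  have h : depth p < depth (some w) := by omega
  rw [treeResistance, Sym2.lift_mk]
  dsimp only
  rw [if_pos h]
  simp [parentEdgeResistance, depth]

lemma current_of_isParent (x : List Bool → ℝ) (U : Vertex n → ℝ) {p : Vertex n} {w : Word n}
    (hp : IsParent p (some w)) :
    current (treeResistance x) U p (some w) = (U p - U (some w)) / (2 ^ w.1.length * x w.1) := by
  rw [current, treeResistance_of_isParent x hp]

lemma current_swap {V : Type*} (r : Sym2 V → ℝ) (U : V → ℝ) (u v : V) :
    current r U u v = -current r U v u := by
  rw [current, current, Sym2.eq_swap, ← neg_div, neg_sub]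

/-! ### Currents and existence of the voltage. -/

/-- In any voltage, the subtree below an edge acts as a single edge. -/
lemma IsVoltage.current_eq {x : List Bool → ℝ} (hx : ∀ w, 0 < x w) {U : Vertex n → ℝ}
    (hU : IsVoltage (edgeRootedTree n) (treeResistance x) (root n) (leaves n) U) (k : ℕ) :
    ∀ w : Word n, w.1.length + k + 1 = n → ∀ p : Vertex n, IsParent p (some w) →
      current (treeResistance x) U p (some w) =
        U p * subtreeConductance k (fun v => x (w.1 ++ v)) / 2 ^ w.1.length := by
  induction k with
  | zero =>
    intro w hw p hp
    have h0 : U (some w) = 0 := hU.eq_zero _ (some_mem_leaves.2 (by omega))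
    rw [current_of_isParent x U hp, h0, subtreeConductance]
    simp [div_eq_mul_inv]
    ring
  | succ k ih =>
    intro w hw p hp
    have h : w.1.length + 1 < n := by omega
    have hnode := hU.node_law (some w) (by simp [root])
      (by rw [some_mem_leaves]; omega)
    rw [sum_adj_node w h hp, current_swap, ih (child w h false) (by simp [child]; omega) _
      (isParent_child ..), ih (child w h true) (by simp [child]; omega) _ (isParent_child ..)]
      at hnode
    rw [subtreeConductance_succ_append]
    have hc := current_of_isParent x U hp
    have c0 := subtreeConductance_pos k (fun v => x ((child w h false).1 ++ v)) fun _ => hx _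
    have c1 := subtreeConductance_pos k (fun v => x ((child w h true).1 ++ v)) fun _ => hx _
    simp only [child, List.length_append, List.length_singleton] at hnode c0 c1
    have hxw := hx w.1
    set i := current (treeResistance x) U p (some w)
    set C₀ := subtreeConductance k fun v => x (w.1 ++ [false] ++ v)
    set C₁ := subtreeConductance k fun v => x (w.1 ++ [true] ++ v)
    -- Kirchhoff's law at `w` gives `e1`, Ohm's law on the edge above `w` gives `e2`; eliminating `U
    -- (some w)` is the series law.
    have e1 : U (some w) * (C₀ + C₁) = i * 2 ^ (w.1.length + 1) := by
      field_simp at hnode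
      linarith
    have e2 : U p - U (some w) = i * (2 ^ w.1.length * x w.1) := by
      rw [hc]; field_simp
    have e3 : U p * (C₀ + C₁) = i * 2 ^ w.1.length * (x w.1 * (C₀ + C₁) + 2) := by
      have : U p = U (some w) + i * (2 ^ w.1.length * x w.1) := by linarith
      rw [this, add_mul, e1]; ring
    have e4 : x w.1 + 2 / (C₀ + C₁) = (x w.1 * (C₀ + C₁) + 2) / (C₀ + C₁) := by
      field_simp
    rw [e4, one_div_div, mul_div_assoc', e3]
    field_simp

/-- The voltage of the edge-rooted tree. -/
noncomputable def treeVoltage (n : ℕ) (x : List Bool → ℝ) : Vertex n → ℝ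
  | none => 1
  -- Crossing an edge of weight `x` above a subtree of conductance `C`, edge included, multiplies
  -- the voltage by `1 - x * C`; the product runs over the path from the root, with `n - 1 - i`
  -- levels below the `i`-th edge.
  | some w => ∏ i ∈ Finset.range (w.1.length + 1),
      (1 - x (w.1.take i) * subtreeConductance (n - 1 - i) (fun v => x (w.1.take i ++ v)))

lemma treeVoltage_of_isParent (x : List Bool → ℝ) {p : Vertex n} {w : Word n}
    (hp : IsParent p (some w)) : treeVoltage n x (some w) = treeVoltage n x p *
      (1 - x w.1 * subtreeConductance (n - 1 - w.1.length) (fun v => x (w.1 ++ v))) := by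
  rw [treeVoltage, Finset.prod_range_succ, List.take_length]
  congr 1
  match p, hp with
  | none, hp =>
    have : w.1 = [] := hp
    simp [this, treeVoltage]
  | some p, ⟨c, hc⟩ =>
    rw [treeVoltage, hc, List.length_append, List.length_singleton]
    refine Finset.prod_congr rfl fun i hi => ?_
    rw [List.take_append_of_le_length]
    have := Finset.mem_range.1 hi
    omega

lemma isVoltage_treeVoltage (hn : 0 < n) {x : List Bool → ℝ} (hx : ∀ w, 0 < x w) :
    IsVoltage (edgeRootedTree n) (treeResistance x) (root n) (leaves n) (treeVoltage n x) := by
  have cur : ∀ (w : Word n) (p : Vertex n), IsParent p (some w) →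
      current (treeResistance x) (treeVoltage n x) p (some w) = treeVoltage n x p *
        subtreeConductance (n - 1 - w.1.length) (fun v => x (w.1 ++ v)) / 2 ^ w.1.length := by
    intro w p hp
    have hxw := hx w.1
    rw [current_of_isParent x _ hp, treeVoltage_of_isParent x hp]
    field_simp
    ring
  refine ⟨?_, ?_, ?_⟩
  · intro u hu
    obtain rfl : u = none := by simpa [root] using hu
    rfl
  · intro v hv
    match v with
    | none => exact absurd (mem_leaves.1 hv) hn.ne
    | some w =>
      rw [some_mem_leaves] at hv
      obtain ⟨p, hp⟩ := exists_isParent w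
      -- At a leaf the last factor is `1 - x * (1 / x) = 0`.
      have : n - 1 - w.1.length = 0 := by omega
      have hxw := hx w.1
      rw [treeVoltage_of_isParent x hp, this, subtreeConductance]
      simp [hxw.ne']
  · intro u hu hv
    match u with
    | none => simp [root] at hu
    | some w =>
      have h : w.1.length + 1 < n := by
        have := w.2
        rw [some_mem_leaves] at hv
        omega
      obtain ⟨p, hp⟩ := exists_isParent w
      rw [sum_adj_node w h hp, current_swap, cur w p hp, cur _ _ (isParent_child w h false),
        cur _ _ (isParent_child w h true), treeVoltage_of_isParent x hp]
      obtain ⟨k, hk⟩ : ∃ k, n - 1 - w.1.length = k + 1 := ⟨n - 2 - w.1.length, by omega⟩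
      have hk' : n - 1 - (w.1.length + 1) = k := by omega
      have c0 := subtreeConductance_pos k (fun v => x (w.1 ++ [false] ++ v)) fun _ => hx _
      have c1 := subtreeConductance_pos k (fun v => x (w.1 ++ [true] ++ v)) fun _ => hx _
      have hxw := hx w.1
      simp only [child, List.length_append, List.length_singleton, hk, hk',
        subtreeConductance_succ_append]
      set C₀ := subtreeConductance k fun v => x (w.1 ++ [false] ++ v)
      set C₁ := subtreeConductance k fun v => x (w.1 ++ [true] ++ v)
      field_simp
      ring

/-- `treeVoltage` rules out the default value `0`. Uniqueness of the voltage is not needed: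
`IsVoltage.current_eq` determines the root current of whichever voltage is chosen. -/
theorem treeConductance_succ (k : ℕ) {x : List Bool → ℝ} (hx : ∀ w, 0 < x w) :
    treeConductance (k + 1) x = subtreeConductance k x := by
  have hex : ∃ U, IsVoltage (edgeRootedTree (k + 1)) (treeResistance x) (root (k + 1))
      (leaves (k + 1)) U := ⟨_, isVoltage_treeVoltage k.succ_pos hx⟩
  rw [treeConductance, effectiveConductance, dif_pos hex, sum_root,
    sum_adj_root k.succ_pos,
    hex.choose_spec.current_eq hx k ⟨[], k.succ_pos⟩ (by simp) none rfl,
    hex.choose_spec.eq_one none (by simp [root])]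
  simp

end Tree

/-! ### Asymptotics of the recursions for the mean and the variance -/

/-- A geometric contraction with forcing of order `N⁻⁴` inherits that order, once `N` is so large
that `N⁻⁴` decays more slowly than the contraction. The a priori bound covers `N ≤ 30`, whence `900
= 30²`; beyond that, `3/4 + 1/10 = 17/20` is below `(29/30)⁴`. -/
lemma le_div_pow_four_of_contraction {A C : ℝ} (hA : 0 ≤ A) (hC : 0 ≤ C) {V : ℕ → ℝ}
    (hV : ∀ k : ℕ, V k ≤ A / ((k : ℝ) + 1) ^ 2)
    (hstep : ∀ k : ℕ, V (k + 1) ≤ 3 / 4 * V k + C / ((k : ℝ) + 1) ^ 4) (k : ℕ) :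
    V k ≤ (900 * A + 10 * C) / ((k : ℝ) + 1) ^ 4 := by
  have small : ∀ k : ℕ, (k : ℝ) + 1 ≤ 30 → V k ≤ (900 * A + 10 * C) / ((k : ℝ) + 1) ^ 4 := by
    intro k hk
    have hN : (0 : ℝ) < (k : ℝ) + 1 := by positivity
    refine (hV k).trans ?_
    rw [div_le_div_iff₀ (by positivity) (by positivity)]
    have h2 : ((k : ℝ) + 1) ^ 2 ≤ 900 := by nlinarith
    have h3 : A * ((k : ℝ) + 1) ^ 2 ≤ 900 * A := by nlinarith
    calc A * ((k : ℝ) + 1) ^ 4 = A * ((k : ℝ) + 1) ^ 2 * ((k : ℝ) + 1) ^ 2 := by ring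
      _ ≤ (900 * A + 10 * C) * ((k : ℝ) + 1) ^ 2 := by gcongr; linarith
  induction k with
  | zero => exact small 0 (by norm_num)
  | succ k ih =>
    rcases le_or_gt ((k : ℝ) + 1) 29 with hk | hk
    · exact small _ (by push_cast; linarith)
    set K := 900 * A + 10 * C with hK
    have hKC : 10 * C ≤ K := by linarith
    push_cast
    set N : ℝ := (k : ℝ) + 1 with hN
    have hN0 : 0 < N := by linarith
    have h1 : N + 1 ≤ 30 / 29 * N := by linarith
    have h2 : (N + 1) ^ 4 ≤ (30 / 29 * N) ^ 4 := by gcongr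
    have h3 : (N + 1) ^ 4 * (17 / 20) ≤ N ^ 4 := by
      have : 0 < N ^ 4 := by positivity
      nlinarith
    calc V (k + 1) ≤ 3 / 4 * (K / N ^ 4) + C / N ^ 4 := by linarith [hstep k]
      _ = (3 / 4 * K + C) / N ^ 4 := by ring
      _ ≤ (17 / 20 * K) / N ^ 4 := by gcongr; linarith
      _ ≤ K / (N + 1) ^ 4 := by
        rw [div_le_div_iff₀ (by positivity) (by positivity)]
        have : 0 ≤ K := by positivity
        nlinarith

/-- `F - s / F` is an approximate inverse of `1 / F + s / F³`: their product is `1 - s² / F⁴`. -/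
lemma abs_one_div_sub_le {e F s ε : ℝ} (he : 0 < e) (hF : 0 < F) (hs : 0 ≤ s)
    (h : |e - 1 / F - s / F ^ 3| ≤ ε) :
    |1 / e - F + s / F| ≤ 1 / e * (s ^ 2 / F ^ 4 + ε * (F + s / F)) := by
  have key : 1 / e - F + s / F =
      1 / e * (s ^ 2 / F ^ 4 - (e - 1 / F - s / F ^ 3) * (F - s / F)) := by
    field_simp
    ring
  rw [key, abs_mul, abs_of_pos (by positivity : 0 < 1 / e)]
  gcongr
  refine (abs_sub _ _).trans ?_
  rw [abs_mul, abs_of_nonneg (by positivity : 0 ≤ s ^ 2 / F ^ 4)]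
  have h1 : |F - s / F| ≤ F + s / F := by
    refine (abs_sub _ _).trans_eq ?_
    rw [abs_of_pos hF, abs_of_nonneg (by positivity)]
  have hε : 0 ≤ ε := (abs_nonneg _).trans h
  gcongr

lemma abs_log_succ_sub_log_sub_le {N : ℝ} (hN : 1 ≤ N) :
    |Real.log (N + 1) - Real.log N - 1 / (N + 1)| ≤ 1 / N ^ 2 := by
  have h0 : 0 < N := by linarith
  have h1 : Real.log (N + 1) - Real.log N ≤ 1 / N := by
    rw [← Real.log_div (by linarith) h0.ne']
    refine (Real.log_le_sub_one_of_pos (by positivity)).trans_eq ?_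
    field_simp; ring
  have h2 : 1 / (N + 1) ≤ Real.log (N + 1) - Real.log N := by
    have := Real.log_le_sub_one_of_pos (show 0 < N / (N + 1) by positivity)
    rw [Real.log_div h0.ne' (by linarith)] at this
    have e : N / (N + 1) - 1 = -(1 / (N + 1)) := by field_simp; ring
    linarith
  rw [abs_of_nonneg (by linarith)]
  have h3 : 1 / N - 1 / (N + 1) ≤ 1 / N ^ 2 := by
    rw [div_sub_div _ _ (by positivity) (by positivity), div_le_div_iff₀ (by positivity)
      (by positivity)]
    nlinarith
  linarith

/-- This and the next lemma replace sums of `1 / N` and `N ^ (-3/2)` by telescoping bounds suited to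
induction. -/
lemma one_div_le_sqrt_succ_sub_sqrt {N : ℝ} (hN : 1 ≤ N) :
    1 / N ≤ 3 * (√(N + 1) - √N) := by
  have hr := Real.sq_sqrt (show 0 ≤ N by linarith)
  have ht := Real.sq_sqrt (show 0 ≤ N + 1 by linarith)
  have hr1 : 1 ≤ √N := Real.one_le_sqrt.2 hN
  have hrt : √N < √(N + 1) := Real.sqrt_lt_sqrt (by linarith) (by linarith)
  set r := √N
  set t := √(N + 1)
  have h : (t - r) * (t + r) = 1 := by nlinarith
  have h2 : t + r ≤ 3 * N := by nlinarith
  rw [div_le_iff₀ (by linarith)]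
  nlinarith

lemma sqrt_div_sq_le_one_div_sqrt_sub {N : ℝ} (hN : 1 ≤ N) :
    √N / N ^ 2 ≤ 4 * (1 / √N - 1 / √(N + 1)) := by
  have hr := Real.sq_sqrt (show 0 ≤ N by linarith)
  have ht := Real.sq_sqrt (show 0 ≤ N + 1 by linarith)
  have hr1 : 1 ≤ √N := Real.one_le_sqrt.2 hN
  have hrt : √N < √(N + 1) := Real.sqrt_lt_sqrt (by linarith) (by linarith)
  set r := √N
  set t := √(N + 1)
  have h : (t - r) * (t + r) = 1 := by nlinarith
  have h2 : t ≤ 3 / 2 * r := by nlinarith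
  have h0 : 0 < r := by linarith
  have h0' : 0 < t := by linarith
  have e : 1 / r - 1 / t = 1 / (r * t * (t + r)) := by
    field_simp
    nlinarith
  rw [← hr, e, mul_one_div, div_le_div_iff₀ (by positivity) (by positivity)]
  have h3 : t * (t + r) ≤ 4 * r ^ 2 := by nlinarith
  calc r * (r * t * (t + r)) = r ^ 2 * (t * (t + r)) := by ring
    _ ≤ r ^ 2 * (4 * r ^ 2) := by gcongr
    _ = 4 * (r ^ 2) ^ 2 := by ring

lemma log_le_two_mul_sqrt {N : ℝ} (hN : 1 ≤ N) : Real.log N ≤ 2 * √N := by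
  have h : 0 < √N := Real.sqrt_pos.2 (by linarith)
  have := Real.log_le_sub_one_of_pos h
  rw [Real.log_sqrt (by linarith)] at this
  linarith

/-- A sequence with `f (k + 1) = f k + μ - s / (f k + μ) + O(1 / k²)` satisfies
`f k = μ k - (s / μ) log k + O(1)`. -/
lemma exists_abs_sub_add_log_le {a b K : ℝ} (ha : 0 < a) (hab : a ≤ b) (hK : 0 ≤ K) :
    ∃ M : ℝ, 0 ≤ M ∧ ∀ (f : ℕ → ℝ) (μ s : ℝ), a ≤ μ → μ ≤ b → 0 ≤ s → s ≤ b ^ 2 →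
      (∀ k : ℕ, a * ((k : ℝ) + 1) ≤ f k) → f 0 ≤ b →
      (∀ k : ℕ, |f (k + 1) - (f k + μ) + s / (f k + μ)| ≤ K / ((k : ℝ) + 1) ^ 2) →
      ∀ k : ℕ, |f k - μ * ((k : ℝ) + 1) + s / μ * Real.log ((k : ℝ) + 1)| ≤ M := by
  have hb : 0 < b := ha.trans_le hab
  set B₁ := b ^ 2 / a + K + b with hB₁
  have hB₁0 : 0 ≤ B₁ := by positivity
  set B₂ := b ^ 2 * (3 * B₁) / a ^ 2 + K + b ^ 2 / a with hB₂
  have hB₂0 : 0 ≤ B₂ := by positivity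
  refine ⟨b + 4 * B₂, by positivity, fun f μ s haμ hμb hs hsb hf hf0 hrec => ?_⟩
  have hμ : 0 < μ := ha.trans_le haμ
  -- A crude first pass. The true deviation is logarithmic, but `√N` suffices: the error it causes
  -- in the second pass is `√N / N²`, which is summable.
  have hg : ∀ k : ℕ, |f k - μ * ((k : ℝ) + 1)| ≤ 3 * B₁ * √((k : ℝ) + 1) := by
    intro k
    induction k with
    | zero =>
      have := hf 0
      have hb' : b ≤ B₁ := by rw [hB₁]; linarith [show 0 ≤ b ^ 2 / a by positivity]
      simp only [Nat.cast_zero, zero_add, mul_one, Real.sqrt_one] at this ⊢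
      rw [abs_le]
      constructor <;> linarith
    | succ k ih =>
      have hr := hrec k
      have hfk := hf k
      push_cast
      have hN : 1 ≤ (k : ℝ) + 1 := by simp
      set N : ℝ := (k : ℝ) + 1
      have hN0 : 0 < N := by linarith
      have hF : a * N ≤ f k + μ := by linarith
      have h1 : s / (f k + μ) ≤ b ^ 2 / (a * N) := by gcongr
      have h1' : 0 ≤ s / (f k + μ) := div_nonneg hs ((by positivity : 0 ≤ a * N).trans hF)
      have h2 : K / N ^ 2 ≤ K / N := by
        gcongr; nlinarith
      have h3 : |f (k + 1) - μ * (N + 1)| ≤ |f k - μ * N| + (s / (f k + μ) + K / N ^ 2) := by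
        have e : f (k + 1) - μ * (N + 1) = (f k - μ * N) +
            (-(s / (f k + μ)) + (f (k + 1) - (f k + μ) + s / (f k + μ))) := by ring
        rw [e]
        refine (abs_add_le _ _).trans ?_
        gcongr
        refine (abs_add_le _ _).trans ?_
        rw [abs_neg, abs_of_nonneg h1']
        gcongr
      have h4 : b ^ 2 / (a * N) + K / N ≤ B₁ * (1 / N) := by
        have : b ^ 2 / (a * N) + K / N = (b ^ 2 / a + K) * (1 / N) := by field_simp
        rw [this]
        gcongr
        linarith
      have h5 : B₁ * (1 / N) ≤ B₁ * (3 * (√(N + 1) - √N)) := by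
        gcongr
        exact one_div_le_sqrt_succ_sub_sqrt hN
      linarith
  -- The bound carried through the induction increases with `k` by the telescoping increments that
  -- dominate `√N / N²`.
  have hh : ∀ k : ℕ, |f k - μ * ((k : ℝ) + 1) + s / μ * Real.log ((k : ℝ) + 1)| ≤
      b + 4 * B₂ * (1 - 1 / √((k : ℝ) + 1)) := by
    intro k
    induction k with
    | zero =>
      have := hf 0
      simp only [Nat.cast_zero, zero_add, mul_one, Real.sqrt_one, Real.log_one] at this ⊢
      rw [abs_le]
      constructor <;> linarith
    | succ k ih =>
      have hr := hrec k
      have hfk := hf k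
      have hgk := hg k
      push_cast
      have hN : 1 ≤ (k : ℝ) + 1 := by simp
      set N : ℝ := (k : ℝ) + 1
      have hN0 : 0 < N := by linarith
      have hF : a * N ≤ f k + μ := by linarith
      have hF0 : 0 < f k + μ := (by positivity : 0 < a * N).trans_le hF
      have hlog := abs_log_succ_sub_log_sub_le hN
      -- Three errors, matching the three terms of `B₂`: replacing `f k + μ` by `μ * (N + 1)` in the
      -- drift, the error of the recursion, and replacing `1 / (N + 1)` by the increment of the
      -- logarithm.
      have e : f (k + 1) - μ * (N + 1) + s / μ * Real.log (N + 1) =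
          (f k - μ * N + s / μ * Real.log N) +
          (s * (f k - μ * N) / ((f k + μ) * (μ * (N + 1))) +
            (f (k + 1) - (f k + μ) + s / (f k + μ)) +
            s / μ * (Real.log (N + 1) - Real.log N - 1 / (N + 1))) := by
        field_simp
        ring
      have hd : (a * N) * (a * N) ≤ (f k + μ) * (μ * (N + 1)) := by
        gcongr; linarith
      have t1 : |s * (f k - μ * N) / ((f k + μ) * (μ * (N + 1)))| ≤
          b ^ 2 * (3 * B₁) / a ^ 2 * (√N / N ^ 2) := by
        rw [abs_div, abs_mul, abs_of_nonneg hs, abs_of_pos (by positivity :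
          0 < (f k + μ) * (μ * (N + 1)))]
        calc _ ≤ b ^ 2 * (3 * B₁ * √N) / ((a * N) * (a * N)) := by gcongr
          _ = _ := by field_simp
      have t2 : ∀ c, 0 ≤ c → c / N ^ 2 ≤ c * (√N / N ^ 2) := by
        intro c hc
        rw [mul_div_assoc']
        gcongr
        exact le_mul_of_one_le_right hc (Real.one_le_sqrt.2 hN)
      have t3 : |s / μ * (Real.log (N + 1) - Real.log N - 1 / (N + 1))| ≤
          b ^ 2 / a / N ^ 2 := by
        rw [abs_mul, abs_of_nonneg (by positivity)]
        calc _ ≤ b ^ 2 / a * (1 / N ^ 2) := by gcongr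
          _ = _ := by ring
      have t4 := t2 K hK
      have t5 := t2 (b ^ 2 / a) (by positivity)
      have t6 : B₂ * (√N / N ^ 2) ≤ B₂ * (4 * (1 / √N - 1 / √(N + 1))) := by
        gcongr
        exact sqrt_div_sq_le_one_div_sqrt_sub hN
      have t7 : B₂ * (√N / N ^ 2) = b ^ 2 * (3 * B₁) / a ^ 2 * (√N / N ^ 2) +
        K * (√N / N ^ 2) + b ^ 2 / a * (√N / N ^ 2) := by rw [hB₂]; ring
      rw [e]
      refine (abs_add_le _ _).trans ?_
      refine (add_le_add ih (abs_add_three _ _ _)).trans ?_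
      linarith
  intro k
  refine (hh k).trans ?_
  have : 0 ≤ B₂ * (1 / √((k : ℝ) + 1)) := by positivity
  linarith

/-- Inverting `f = μ N - (s / μ) log N + O(1)`. -/
lemma exists_abs_one_div_sub_le {a b M : ℝ} (ha : 0 < a) (hab : a ≤ b) (hM : 0 ≤ M) :
    ∃ M' : ℝ, ∀ f μ s N : ℝ, a ≤ μ → 0 ≤ s → s ≤ b ^ 2 → 1 ≤ N → a * N ≤ f →
      |f - μ * N + s / μ * Real.log N| ≤ M →
      |1 / f - 1 / (μ * N) - s * Real.log N / (μ ^ 3 * N ^ 2)| ≤ M' / N ^ 2 := by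
  have hb : 0 < b := ha.trans_le hab
  set c := b ^ 2 / a * 2 with hc
  refine ⟨c * (c + M) / a ^ 3 + M / a ^ 2, fun f μ s N haμ hs hsb hN haf h => ?_⟩
  have hμ : 0 < μ := ha.trans_le haμ
  have hN0 : 0 < N := by linarith
  have hf : 0 < f := (by positivity : 0 < a * N).trans_le haf
  have hlog := log_le_two_mul_sqrt hN
  have hlog0 := Real.log_nonneg hN
  have hr1 : 1 ≤ √N := Real.one_le_sqrt.2 hN
  have hr := Real.sq_sqrt hN0.le
  set L := Real.log N
  set q := s / μ * L with hq
  set θ := f - μ * N + q with hθ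
  have hq0 : 0 ≤ q := by positivity
  -- Enough because `q` enters squared over a cube of order `N³`, leaving `N / N³`.
  have hqc : q ≤ c * √N := by
    calc q ≤ b ^ 2 / a * (2 * √N) := by rw [hq]; gcongr
      _ = c * √N := by rw [hc]; ring
  have e : 1 / f - 1 / (μ * N) - s * L / (μ ^ 3 * N ^ 2) =
      q * (q - θ) / (f * (μ * N) ^ 2) - θ / (f * (μ * N)) := by
    have h1 : s * L / (μ ^ 3 * N ^ 2) = q / (μ * N) ^ 2 := by rw [hq]; field_simp
    have h2 : q - θ = μ * N - f := by rw [hθ]; ring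
    have h3 : θ = f - μ * N + q := hθ
    rw [h1, h2, h3]
    field_simp
    ring
  have t1 : |q * (q - θ) / (f * (μ * N) ^ 2)| ≤ c * (c + M) / a ^ 3 / N ^ 2 := by
    rw [abs_div, abs_mul, abs_of_nonneg hq0, abs_of_pos (by positivity : 0 < f * (μ * N) ^ 2)]
    have h1 : |q - θ| ≤ (c + M) * √N := by
      refine (abs_sub _ _).trans ?_
      rw [abs_of_nonneg hq0]
      nlinarith
    calc _ ≤ (c * √N) * ((c + M) * √N) / (a * N * (a * N) ^ 2) := by gcongr
      _ = c * (c + M) * √N ^ 2 / (a * N * (a * N) ^ 2) := by ring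
      _ = _ := by rw [hr]; field_simp
  have t2 : |θ / (f * (μ * N))| ≤ M / a ^ 2 / N ^ 2 := by
    rw [abs_div, abs_of_pos (by positivity : 0 < f * (μ * N))]
    calc _ ≤ M / (a * N * (a * N)) := by gcongr
      _ = _ := by field_simp
  rw [e, add_div _ _ (N ^ 2)]
  exact (abs_sub _ _).trans (add_le_add t1 t2)

/-- The combined asymptotics for the mean `e k` and the variance `V k`. -/
lemma exists_bounds_of_recursion {a b : ℝ} (ha : 0 < a) (hab : a ≤ b) :
    ∃ M K : ℝ, 0 ≤ M ∧ 0 ≤ K ∧ ∀ (e V : ℕ → ℝ) (μ s : ℝ), a ≤ μ → μ ≤ b → 0 ≤ s → s ≤ b ^ 2 →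
      (∀ k : ℕ, 1 / (b * ((k : ℝ) + 1)) ≤ e k) → (∀ k : ℕ, e k ≤ 1 / (a * ((k : ℝ) + 1))) →
      (∀ k : ℕ, V k ≤ (1 / (a * ((k : ℝ) + 1))) ^ 2) →
      (∀ k : ℕ, V (k + 1) ≤ 3 / 4 * V k + 3 * (b - a) ^ 2 / (a * ((k : ℝ) + 1)) ^ 4) →
      (∀ k : ℕ, |e (k + 1) - 1 / (1 / e k + μ) - s / (1 / e k + μ) ^ 3| ≤
        b * V k + (b - a) ^ 3 / (a * ((k : ℝ) + 1)) ^ 4) →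
      ∀ k : ℕ, V k ≤ K / ((k : ℝ) + 1) ^ 4 ∧
        |1 / e k - μ * ((k : ℝ) + 1) + s / μ * Real.log ((k : ℝ) + 1)| ≤ M := by
  have hb : 0 < b := ha.trans_le hab
  have hba : 0 ≤ b - a := by linarith
  set K := 900 * (1 / a ^ 2) + 10 * (3 * (b - a) ^ 2 / a ^ 4) with hK
  have hK0 : 0 ≤ K := by positivity
  -- `K₂` bounds the error for the mean on the scale `N⁻⁴`; `K₃` bounds that for its reciprocal on
  -- the scale `N⁻²`.
  set K₂ := b * K + (b - a) ^ 3 / a ^ 4 with hK₂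
  have hK₂0 : 0 ≤ K₂ := by positivity
  set K₃ := 2 * b * (b ^ 4 / a ^ 4 + K₂ * (2 * b + b ^ 2 / a)) with hK₃
  have hK₃0 : 0 ≤ K₃ := by positivity
  obtain ⟨M, hM0, hM⟩ := exists_abs_sub_add_log_le ha hab hK₃0
  refine ⟨M, K, hM0, hK0, fun e V μ s haμ hμb hs hsb hel heu hVb hVr her => ?_⟩
  have hV : ∀ k : ℕ, V k ≤ K / ((k : ℝ) + 1) ^ 4 := by
    refine le_div_pow_four_of_contraction (by positivity) (by positivity) (fun k => ?_)
      (fun k => ?_)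
    · refine (hVb k).trans_eq ?_
      field_simp
    · refine (hVr k).trans_eq ?_
      field_simp
  have he0 : ∀ k : ℕ, 0 < e k := fun k => (by positivity : 0 < 1 / (b * ((k : ℝ) + 1))).trans_le
    (hel k)
  have hfl : ∀ k : ℕ, a * ((k : ℝ) + 1) ≤ 1 / e k := fun k => by
    rw [le_one_div (by positivity) (he0 k)]; exact heu k
  have hfu : ∀ k : ℕ, 1 / e k ≤ b * ((k : ℝ) + 1) := fun k => by
    rw [one_div_le (he0 k) (by positivity)]; exact hel k
  intro k
  refine ⟨hV k, hM (fun k => 1 / e k) μ s haμ hμb hs hsb hfl (by simpa using hfu 0) ?_ k⟩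
  intro k
  have hfl' := hfl k
  have hfu' := hfu k
  have hfu2 := hfu (k + 1)
  have hVk := hV k
  have her' := her k
  push_cast at hfu2
  have hN : 1 ≤ (k : ℝ) + 1 := by simp
  set N : ℝ := (k : ℝ) + 1
  have hN0 : 0 < N := by linarith
  set F := 1 / e k + μ with hF
  have hF1 : a * N ≤ F := by linarith [ha.trans_le haμ]
  have hF2 : F ≤ 2 * b * N := by nlinarith
  have hF0 : 0 < F := (by positivity : 0 < a * N).trans_le hF1
  have hε : |e (k + 1) - 1 / F - s / F ^ 3| ≤ K₂ / N ^ 4 := by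
    refine her'.trans ?_
    calc _ ≤ b * (K / N ^ 4) + (b - a) ^ 3 / (a * N) ^ 4 := by gcongr
      _ = _ := by rw [hK₂]; field_simp
  have hmain := abs_one_div_sub_le (he0 (k + 1)) hF0 hs hε
  refine hmain.trans ?_
  have h1 : 1 / e (k + 1) ≤ 2 * b * N := by nlinarith
  have h2 : s ^ 2 / F ^ 4 ≤ b ^ 4 / a ^ 4 / N ^ 3 := by
    calc _ ≤ (b ^ 2) ^ 2 / (a * N) ^ 4 := by gcongr
      _ = b ^ 4 / a ^ 4 / N ^ 4 := by field_simp
      _ ≤ _ := by gcongr; norm_num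
  have h3 : F + s / F ≤ (2 * b + b ^ 2 / a) * N := by
    have : s / F ≤ b ^ 2 / a * N := by
      calc _ ≤ b ^ 2 / (a * N) := by gcongr
        _ = b ^ 2 / a / N := by field_simp
        _ ≤ b ^ 2 / a := div_le_self (by positivity) hN
        _ ≤ _ := le_mul_of_one_le_right (by positivity) hN
    linarith
  calc _ ≤ 2 * b * N * (b ^ 4 / a ^ 4 / N ^ 3 + K₂ / N ^ 4 * ((2 * b + b ^ 2 / a) * N)) := by
        gcongr
    _ = K₃ / N ^ 2 := by rw [hK₃]; field_simp

/-! ### One step of the recursion for the mean and the variance -/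

section Probability

variable {Ω : Type*} [MeasurableSpace Ω] {P : Measure Ω}

lemma memLp_of_mem_Icc [IsProbabilityMeasure P] {f : Ω → ℝ} {l u : ℝ}
    (hf : AEStronglyMeasurable f P) (h : ∀ᵐ ω ∂P, f ω ∈ Set.Icc l u) (p : ENNReal) :
    MemLp f p P :=
  memLp_of_bounded h hf p

lemma integrable_of_mem_Icc [IsProbabilityMeasure P] {f : Ω → ℝ} {l u : ℝ}
    (hf : AEStronglyMeasurable f P) (h : ∀ᵐ ω ∂P, f ω ∈ Set.Icc l u) : Integrable f P :=
  memLp_one_iff_integrable.1 (memLp_of_mem_Icc hf h 1)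

lemma integral_mem_Icc [IsProbabilityMeasure P] {f : Ω → ℝ} {l u : ℝ}
    (hf : AEStronglyMeasurable f P) (h : ∀ᵐ ω ∂P, f ω ∈ Set.Icc l u) :
    ∫ ω, f ω ∂P ∈ Set.Icc l u := by
  have hi := integrable_of_mem_Icc hf h
  constructor
  · have := integral_mono_ae (integrable_const l) hi (h.mono fun ω hω => hω.1)
    simpa using this
  · have := integral_mono_ae hi (integrable_const u) (h.mono fun ω hω => hω.2)
    simpa using this

lemma variance_le_sq_of_mem_Icc [IsProbabilityMeasure P] {f : Ω → ℝ} {l u : ℝ} (hl : 0 ≤ l)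
    (hf : AEStronglyMeasurable f P) (h : ∀ᵐ ω ∂P, f ω ∈ Set.Icc l u) :
    Var[f; P] ≤ u ^ 2 := by
  refine (variance_le_expectation_sq hf).trans ?_
  refine (integral_mem_Icc (l := 0) (hf.pow 2) ?_).2
  filter_upwards [h] with ω hω
  have : 0 ≤ f ω := hl.trans hω.1
  exact ⟨by simp only [Pi.pow_apply]; positivity, by simp only [Pi.pow_apply]; gcongr; exact hω.2⟩

/-- The variance of the conductance of a resistor `X` in series with two resistors of conductances
`Y₀ / 2` and `Y₁ / 2` in parallel, and the expansion of its mean. -/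
lemma series_parallel_mean_variance [IsProbabilityMeasure P] {X Y₀ Y₁ : Ω → ℝ}
    {a b l u μ s e V : ℝ} (ha : 0 < a) (hl : 0 < l)
    (mX : Measurable X) (mY₀ : Measurable Y₀) (mY₁ : Measurable Y₁)
    (hind : IndepFun Y₀ Y₁ P) (hindX : IndepFun (fun ω => (Y₀ ω + Y₁ ω) / 2) X P)
    (hX : ∀ᵐ ω ∂P, X ω ∈ Set.Icc a b)
    (hY₀ : ∀ᵐ ω ∂P, Y₀ ω ∈ Set.Icc l u) (hY₁ : ∀ᵐ ω ∂P, Y₁ ω ∈ Set.Icc l u)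
    (EX : ∫ ω, X ω ∂P = μ) (VX : Var[X; P] = s)
    (EY₀ : ∫ ω, Y₀ ω ∂P = e) (EY₁ : ∫ ω, Y₁ ω ∂P = e)
    (VY₀ : Var[Y₀; P] = V) (VY₁ : Var[Y₁; P] = V) :
    Var[fun ω => 1 / (X ω + 2 / (Y₀ ω + Y₁ ω)); P] ≤ 3 / 4 * V + 3 * (b - a) ^ 2 * u ^ 4 ∧
    |∫ ω, 1 / (X ω + 2 / (Y₀ ω + Y₁ ω)) ∂P - 1 / (1 / e + μ) - s / (1 / e + μ) ^ 3| ≤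
      b * V + (b - a) ^ 3 * u ^ 4 := by
  set A : Ω → ℝ := fun ω => (Y₀ ω + Y₁ ω) / 2 with hAdef
  set Z : Ω → ℝ := fun ω => 1 / (X ω + 2 / (Y₀ ω + Y₁ ω)) with hZdef
  have mA : Measurable A := by fun_prop
  have mZ : Measurable Z := by fun_prop
  have hA : ∀ᵐ ω ∂P, A ω ∈ Set.Icc l u := by
    filter_upwards [hY₀, hY₁] with ω h0 h1
    constructor <;> simp only [hAdef] <;> linarith [h0.1, h0.2, h1.1, h1.2]
  have hμ : μ ∈ Set.Icc a b := EX ▸ integral_mem_Icc mX.aestronglyMeasurable hX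
  have he : e ∈ Set.Icc l u := EY₀ ▸ integral_mem_Icc mY₀.aestronglyMeasurable hY₀
  have hμ0 : 0 < μ := ha.trans_le hμ.1
  have hb0 : 0 < b := hμ0.trans_le hμ.2
  have he0 : 0 < e := hl.trans_le he.1
  have hu0 : 0 < u := he0.trans_le he.2
  have iY₀ := integrable_of_mem_Icc mY₀.aestronglyMeasurable hY₀
  have iY₁ := integrable_of_mem_Icc mY₁.aestronglyMeasurable hY₁
  have iX := integrable_of_mem_Icc mX.aestronglyMeasurable hX
  have lA := memLp_of_mem_Icc mA.aestronglyMeasurable hA 2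
  have lX := memLp_of_mem_Icc mX.aestronglyMeasurable hX 2
  have EA : ∫ ω, A ω ∂P = e := by
    simp only [hAdef]
    rw [integral_div, integral_add iY₀ iY₁, EY₀, EY₁]
    ring
  have VA : ∫ ω, (A ω - e) ^ 2 ∂P = V / 2 := by
    have h1 : Var[A; P] = ∫ ω, (A ω - e) ^ 2 ∂P := by
      rw [variance_eq_integral mA.aemeasurable, EA]
    have h2 : A = fun ω => (1 / 2 : ℝ) * (Y₀ + Y₁) ω := by
      funext ω; simp only [hAdef, Pi.add_apply]; ring
    rw [← h1, h2, variance_const_mul, hind.variance_add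
      (memLp_of_mem_Icc mY₀.aestronglyMeasurable hY₀ 2)
      (memLp_of_mem_Icc mY₁.aestronglyMeasurable hY₁ 2), VY₀, VY₁]
    ring
  have VX' : ∫ ω, (X ω - μ) ^ 2 ∂P = s := by
    rw [← VX, variance_eq_integral mX.aemeasurable, EX]
  have iA2 : Integrable (fun ω => (A ω - e) ^ 2) P := (lA.sub (memLp_const e)).integrable_sq
  have iX2 : Integrable (fun ω => (X ω - μ) ^ 2) P := (lX.sub (memLp_const μ)).integrable_sq
  have hZ : ∀ᵐ ω ∂P, Z ω = A ω / (1 + X ω * A ω) := by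
    filter_upwards [hA, hX] with ω h1 h2
    have hA0 : 0 < A ω := hl.trans_le h1.1
    have hX0 : 0 < X ω := ha.trans_le h2.1
    have e1 : 2 / (Y₀ ω + Y₁ ω) = 1 / A ω := by simp only [hAdef]; rw [one_div_div]
    simp only [hZdef]
    rw [e1]
    field_simp
    ring
  constructor
  -- Centre at the value of `Z` for `A = e`, `X = μ`, a point at least as good as needed since the
  -- variance is at most any second moment.
  · have hc : Var[Z; P] = Var[fun ω => Z ω - e / (1 + μ * e); P] :=
      (variance_sub_const mZ.aestronglyMeasurable _).symm
    rw [hc]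
    refine (variance_le_expectation_sq (mZ.sub_const _).aestronglyMeasurable).trans ?_
    have hbound : ∀ᵐ ω ∂P, (Z ω - e / (1 + μ * e)) ^ 2 ≤
        3 / 2 * (A ω - e) ^ 2 + 3 * (b - a) ^ 2 * u ^ 4 := by
      filter_upwards [hZ, hA, hX] with ω h0 h1 h2
      have hA0 : 0 < A ω := hl.trans_le h1.1
      have hX0 : 0 < X ω := ha.trans_le h2.1
      rw [h0]
      have e1 : A ω / (1 + X ω * A ω) - e / (1 + μ * e) =
          (A ω - e) / ((1 + X ω * A ω) * (1 + X ω * e)) +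
            e ^ 2 * (μ - X ω) / ((1 + X ω * e) * (1 + μ * e)) := by
        field_simp
        ring
      have t1 : ((A ω - e) / ((1 + X ω * A ω) * (1 + X ω * e))) ^ 2 ≤ (A ω - e) ^ 2 := by
        rw [div_pow]
        refine div_le_self (sq_nonneg _) (one_le_pow₀ ?_)
        exact one_le_mul_of_one_le_of_one_le (by simp; positivity) (by simp; positivity)
      have t2 : (e ^ 2 * (μ - X ω) / ((1 + X ω * e) * (1 + μ * e))) ^ 2 ≤
          (b - a) ^ 2 * u ^ 4 := by
        rw [div_pow]
        refine (div_le_self (sq_nonneg _) (one_le_pow₀ ?_)).trans ?_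
        · exact one_le_mul_of_one_le_of_one_le (by simp; positivity) (by simp; positivity)
        · have h3 : (μ - X ω) ^ 2 ≤ (b - a) ^ 2 := by
            apply sq_le_sq'
            · linarith [hμ.1, h2.2]
            · linarith [hμ.2, h2.1]
          have h4 : e ^ 4 ≤ u ^ 4 := by gcongr; exact he.2
          calc _ = (μ - X ω) ^ 2 * e ^ 4 := by ring
            _ ≤ _ := by gcongr
      rw [e1]
      set p := (A ω - e) / ((1 + X ω * A ω) * (1 + X ω * e))
      set q := e ^ 2 * (μ - X ω) / ((1 + X ω * e) * (1 + μ * e))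
      -- The unequal weights in `(p + q)² ≤ 3/2 p² + 3 q²` matter: with `E (A - e)² = V / 2`, the
      -- usual factor `2` would leave no contraction.
      nlinarith [sq_nonneg (p - 2 * q)]
    have hi := (iA2.const_mul (3 / 2)).add
      (integrable_const (μ := P) (3 * (b - a) ^ 2 * u ^ 4))
    refine (integral_mono_of_nonneg (Filter.Eventually.of_forall fun ω => sq_nonneg _) hi
      hbound).trans_eq ?_
    simp only [Pi.add_apply]
    rw [integral_add (iA2.const_mul _) (integrable_const _), integral_const_mul, VA]
    simp
    ring
  · set F := 1 / e + μ with hF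
    have hF0 : 0 < F := by positivity
    -- The derivative of `A ↦ A / (1 + x * A)` at `A = e`.
    set h : ℝ → ℝ := fun x => 1 / (1 + x * e) ^ 2 with hh
    have mh : Measurable h := by fun_prop
    have hmul : ∫ ω, (A ω - e) * h (X ω) ∂P = 0 := by
      have hI : IndepFun (fun ω => A ω - e) (fun ω => h (X ω)) P :=
        hindX.comp (φ := fun y => y - e) (by fun_prop) mh
      rw [hI.integral_fun_mul_eq_mul_integral (mA.sub_const e).aestronglyMeasurable
          (mh.comp mX).aestronglyMeasurable,
        integral_sub (lA.integrable (by norm_num)) (integrable_const e), EA]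
      simp
    have ih : Integrable (fun ω => (A ω - e) * h (X ω)) P := by
      refine (((lA.integrable (by norm_num)).sub (integrable_const e)).mul_bdd (c := 1)
        (mh.comp mX).aestronglyMeasurable ?_)
      filter_upwards [hX] with ω h2
      have hX0 : 0 < X ω := ha.trans_le h2.1
      simp only [hh, Real.norm_eq_abs]
      rw [abs_of_nonneg (by positivity)]
      refine div_le_one_of_le₀ (one_le_pow₀ ?_) (by positivity)
      simp; positivity
    have iZ : Integrable Z P := by
      refine integrable_of_mem_Icc (l := 0) (u := u) mZ.aestronglyMeasurable ?_
      filter_upwards [hZ, hA, hX] with ω h0 h1 h2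
      have hA0 : 0 < A ω := hl.trans_le h1.1
      have hX0 : 0 < X ω := ha.trans_le h2.1
      rw [h0]
      refine ⟨by positivity, (div_le_self hA0.le ?_).trans h1.2⟩
      simp; positivity
    have iX1 : Integrable (fun ω => X ω - μ) P := iX.sub (integrable_const μ)
    -- First order in `A` about `e`, plus second order in `X` about `μ` at `A = e`. Both remainders
    -- are computed exactly in `e0` and `e1`.
    set G : Ω → ℝ := fun ω => 1 / F - 1 / F ^ 2 * (X ω - μ) + 1 / F ^ 3 * (X ω - μ) ^ 2 +
      (A ω - e) * h (X ω) with hG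
    have i1 : Integrable (fun ω => 1 / F - 1 / F ^ 2 * (X ω - μ)) P :=
      (integrable_const _).sub (iX1.const_mul _)
    have i2 : Integrable (fun ω => 1 / F - 1 / F ^ 2 * (X ω - μ) + 1 / F ^ 3 * (X ω - μ) ^ 2) P :=
      i1.add (iX2.const_mul _)
    have iG : Integrable G P := i2.add ih
    have EG : ∫ ω, G ω ∂P = 1 / F + s / F ^ 3 := by
      simp only [hG]
      rw [integral_add i2 ih, integral_add i1 (iX2.const_mul _), integral_sub (integrable_const _) (iX1.const_mul _), integral_const_mul,
        integral_const_mul, hmul, VX', integral_sub iX (integrable_const _), EX]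
      simp
      ring
    have hbound : ∀ᵐ ω ∂P, ‖Z ω - G ω‖ ≤ b * (A ω - e) ^ 2 + (b - a) ^ 3 * u ^ 4 := by
      filter_upwards [hZ, hA, hX] with ω h0 h1 h2
      have hA0 : 0 < A ω := hl.trans_le h1.1
      have hX0 : 0 < X ω := ha.trans_le h2.1
      have e0 : A ω / (1 + X ω * A ω) = 1 / (1 / e + X ω) + (A ω - e) * h (X ω) -
          X ω * (A ω - e) ^ 2 / ((1 + X ω * e) ^ 2 * (1 + X ω * A ω)) := by
        simp only [hh]
        field_simp
        ring
      have e1 : 1 / (1 / e + X ω) = 1 / F - 1 / F ^ 2 * (X ω - μ) + 1 / F ^ 3 * (X ω - μ) ^ 2 -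
          (X ω - μ) ^ 3 / (F ^ 3 * (1 / e + X ω)) := by
        have : X ω - μ = (1 / e + X ω) - F := by rw [hF]; ring
        rw [this]
        have : 0 < 1 / e + X ω := by positivity
        field_simp
        ring
      have e2 : Z ω - G ω = -(X ω * (A ω - e) ^ 2 / ((1 + X ω * e) ^ 2 * (1 + X ω * A ω))) -
          (X ω - μ) ^ 3 / (F ^ 3 * (1 / e + X ω)) := by
        rw [h0, e0, e1]
        simp only [hG]
        ring
      rw [e2, Real.norm_eq_abs]
      refine (abs_sub _ _).trans (add_le_add ?_ ?_)
      · rw [abs_neg, abs_of_nonneg (by positivity)]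
        refine (div_le_self (by positivity) ?_).trans ?_
        · exact one_le_mul_of_one_le_of_one_le (one_le_pow₀ (by simp; positivity))
            (by simp; positivity)
        · gcongr; exact h2.2
      · have hu1 : 1 / u ≤ 1 / e := one_div_le_one_div_of_le he0 he.2
        rw [abs_div, abs_pow, abs_of_pos (by positivity : 0 < F ^ 3 * (1 / e + X ω))]
        have h3 : |X ω - μ| ≤ b - a := by
          rw [abs_le]; constructor <;> linarith [hμ.1, hμ.2, h2.1, h2.2]
        have hba : 0 ≤ b - a := (abs_nonneg _).trans h3
        calc _ ≤ (b - a) ^ 3 / ((1 / u) ^ 3 * (1 / u)) := by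
              gcongr
              · linarith
              · linarith
          _ = _ := by field_simp
    have hEZ : ∫ ω, Z ω ∂P - 1 / F - s / F ^ 3 = ∫ ω, (Z ω - G ω) ∂P := by
      rw [integral_sub iZ iG, EG]; ring
    have hi := (iA2.const_mul b).add (integrable_const (μ := P) ((b - a) ^ 3 * u ^ 4))
    rw [hEZ, ← Real.norm_eq_abs]
    refine (norm_integral_le_of_norm_le hi hbound).trans ?_
    simp only [Pi.add_apply]
    rw [integral_add (iA2.const_mul _) (integrable_const _), integral_const_mul, VA]
    have hV : 0 ≤ V := VY₀ ▸ variance_nonneg _ _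
    have : b * (V / 2) ≤ b * V := by gcongr; linarith
    simp
    linarith

/-- Subtract the tangent to `1 / y` at the mean `e`; its linear term integrates to zero and the
remainder is exactly `(y - e)² / (e² y)`. -/
lemma abs_integral_one_div_sub_le [IsProbabilityMeasure P] {Y : Ω → ℝ} {l u : ℝ} (hl : 0 < l)
    (mY : Measurable Y) (hY : ∀ᵐ ω ∂P, Y ω ∈ Set.Icc l u) :
    Integrable (fun ω => 1 / Y ω) P ∧
      |∫ ω, 1 / Y ω ∂P - 1 / ∫ ω, Y ω ∂P| ≤ Var[Y; P] / l ^ 3 := by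
  have he := integral_mem_Icc mY.aestronglyMeasurable hY
  have hvar := variance_eq_integral (μ := P) mY.aemeasurable
  have iY := integrable_of_mem_Icc mY.aestronglyMeasurable hY
  have lY := memLp_of_mem_Icc mY.aestronglyMeasurable hY 2
  set e := ∫ ω, Y ω ∂P with hedef
  have he0 : 0 < e := hl.trans_le he.1
  have iY2 : Integrable (fun ω => (Y ω - e) ^ 2) P := (lY.sub (memLp_const e)).integrable_sq
  have iR : Integrable (fun ω => 1 / Y ω) P := by
    refine integrable_of_mem_Icc (l := 0) (u := 1 / l) (mY.const_div 1).aestronglyMeasurable ?_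
    filter_upwards [hY] with ω h
    have h0 : 0 < Y ω := hl.trans_le h.1
    exact ⟨by positivity, one_div_le_one_div_of_le hl h.1⟩
  refine ⟨iR, ?_⟩
  have iY1 : Integrable (fun ω => Y ω - e) P := iY.sub (integrable_const e)
  have iL : Integrable (fun ω => 1 / e - 1 / e ^ 2 * (Y ω - e)) P :=
    (integrable_const _).sub (iY1.const_mul _)
  have EL : ∫ ω, (1 / e - 1 / e ^ 2 * (Y ω - e)) ∂P = 1 / e := by
    rw [integral_sub (integrable_const _) (iY1.const_mul _),
      integral_const_mul, integral_sub iY (integrable_const _), ← hedef]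
    simp
  have hbound : ∀ᵐ ω ∂P, ‖1 / Y ω - (1 / e - 1 / e ^ 2 * (Y ω - e))‖ ≤
      1 / l ^ 3 * (Y ω - e) ^ 2 := by
    filter_upwards [hY] with ω h
    have h0 : 0 < Y ω := hl.trans_le h.1
    have e1 : 1 / Y ω - (1 / e - 1 / e ^ 2 * (Y ω - e)) = 1 / (e ^ 2 * Y ω) * (Y ω - e) ^ 2 := by
      field_simp
      ring
    rw [e1, Real.norm_eq_abs, abs_of_nonneg (by positivity)]
    gcongr
    calc l ^ 3 = l ^ 2 * l := by ring
      _ ≤ _ := by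
        gcongr
        · exact he.1
        · exact h.1
  have := norm_integral_le_of_norm_le (iY2.const_mul (1 / l ^ 3)) hbound
  rw [integral_sub iR iL, EL, integral_const_mul, ← hvar, Real.norm_eq_abs] at this
  refine this.trans_eq ?_
  ring

/-! ### Independent, identically distributed edge weights -/

lemma _root_.ProbabilityTheory.iIndepFun.indepFun_restrict {ι : Type*} {β : ι → Type*}
    {m : ∀ i, MeasurableSpace (β i)} {X : ∀ i, Ω → β i} (h : iIndepFun X P)
    (hX : ∀ i, Measurable (X i)) {S T : Set ι} (hST : Disjoint S T) :
    IndepFun (fun ω (i : S) => X i ω) (fun ω (i : T) => X i ω) P := by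
  have key : ∀ S : Set ι, MeasurableSpace.comap (fun ω (i : S) => X i ω) MeasurableSpace.pi =
      ⨆ i ∈ S, (m i).comap (X i) := by
    intro S
    rw [MeasurableSpace.pi, MeasurableSpace.comap_iSup, iSup_subtype']
    simp only [MeasurableSpace.comap_comp]
    rfl
  rw [IndepFun_iff_Indep, key, key]
  exact indep_iSup_of_disjoint (fun i => (hX i).comap_le) h.iIndep hST

/-- Injective reindexing preserves independence, so both laws are infinite products of the same
marginal. This gives a subtree the law of a whole tree. -/
lemma identDistrib_subfamily [IsProbabilityMeasure P] {ι κ : Type*} {X : ι → Ω → ℝ}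
    (h : iIndepFun X P) (hX : ∀ i, Measurable (X i))
    (hid : ∀ i j, IdentDistrib (X i) (X j) P P) {g h' : κ → ι} (hg : g.Injective)
    (hh' : h'.Injective) :
    IdentDistrib (fun ω i => X (g i) ω) (fun ω i => X (h' i) ω) P P := by
  refine ⟨(measurable_pi_lambda _ fun i => hX _).aemeasurable,
    (measurable_pi_lambda _ fun i => hX _).aemeasurable, ?_⟩
  rw [(h.precomp hg).map_fun_eq_infinitePi_map fun i => hX _,
    (h.precomp hh').map_fun_eq_infinitePi_map fun i => hX _]
  congr 1
  funext i
  exact (hid _ _).map_eq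

end Probability

section IID

variable {Ω : Type*} [MeasurableSpace Ω] {P : Measure Ω}
  {X : List Bool → Ω → ℝ} {a b : ℝ}

lemma ae_subtreeConductance_mem_Icc (ha : 0 < a) (hab : a ≤ b)
    (hXab : ∀ᵐ ω ∂P, ∀ e, X e ω ∈ Set.Icc a b) (g : List Bool → List Bool) (k : ℕ) :
    ∀ᵐ ω ∂P, subtreeConductance k (fun w => X (g w) ω) ∈
      Set.Icc (1 / (b * ((k : ℝ) + 1))) (1 / (a * ((k : ℝ) + 1))) := by
  filter_upwards [hXab] with ω hω
  exact subtreeConductance_bounds ha hab k _ fun w => hω _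

/-- The labels starting with `false`, those starting with `true`, and `[]` are disjoint, which
yields the independence required by `series_parallel_mean_variance`. -/
lemma subtreeConductance_mean_variance_succ [IsProbabilityMeasure P] {μ s : ℝ} (ha : 0 < a) (hab : a ≤ b)
    (hX : ∀ e, Measurable (X e)) (hind : iIndepFun X P)
    (hid : ∀ e e', IdentDistrib (X e) (X e') P P)
    (hXab : ∀ᵐ ω ∂P, ∀ e, X e ω ∈ Set.Icc a b)
    (hμ : ∫ ω, X [] ω ∂P = μ) (hs : Var[X []; P] = s) (k : ℕ) :
    Var[fun ω => subtreeConductance (k + 1) (fun w => X w ω); P] ≤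
      3 / 4 * Var[fun ω => subtreeConductance k (fun w => X w ω); P] +
        3 * (b - a) ^ 2 / (a * ((k : ℝ) + 1)) ^ 4 ∧
    |∫ ω, subtreeConductance (k + 1) (fun w => X w ω) ∂P -
        1 / (1 / ∫ ω, subtreeConductance k (fun w => X w ω) ∂P + μ) -
        s / (1 / ∫ ω, subtreeConductance k (fun w => X w ω) ∂P + μ) ^ 3| ≤
      b * Var[fun ω => subtreeConductance k (fun w => X w ω); P] +
        (b - a) ^ 3 / (a * ((k : ℝ) + 1)) ^ 4 := by
  have hb : 0 < b := ha.trans_le hab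
  have mC := measurable_subtreeConductance k
  have hinj : ∀ c : Bool, (fun w : List Bool => c :: w).Injective :=
    fun c => List.cons_injective
  have mY : ∀ c : Bool, Measurable fun ω => subtreeConductance k (fun w => X (c :: w) ω) :=
    fun c => mC.comp (measurable_pi_lambda _ fun w => hX _)
  have hdist : ∀ c : Bool, IdentDistrib (fun ω => subtreeConductance k (fun w => X (c :: w) ω))
      (fun ω => subtreeConductance k (fun w => X w ω)) P P := fun c =>
    (identDistrib_subfamily hind hX hid (hinj c) Function.injective_id).comp mC
  have hindY : IndepFun (fun ω => subtreeConductance k (fun w => X (false :: w) ω))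
      (fun ω => subtreeConductance k (fun w => X (true :: w) ω)) P := by
    have hST : Disjoint (Set.range fun w : List Bool => false :: w)
        (Set.range fun w : List Bool => true :: w) := by
      rw [Set.disjoint_left]
      rintro _ ⟨w, rfl⟩ ⟨v, hv⟩
      simp at hv
    exact (hind.indepFun_restrict hX hST).comp
      (φ := fun z => subtreeConductance k fun w => z ⟨false :: w, w, rfl⟩)
      (ψ := fun z => subtreeConductance k fun w => z ⟨true :: w, w, rfl⟩)
      (mC.comp (measurable_pi_lambda _ fun w => measurable_pi_apply _))
      (mC.comp (measurable_pi_lambda _ fun w => measurable_pi_apply _))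
  have hindX : IndepFun (fun ω => (subtreeConductance k (fun w => X (false :: w) ω) +
      subtreeConductance k (fun w => X (true :: w) ω)) / 2) (X []) P := by
    have mroot : Measurable fun z : ({[]} : Set (List Bool)) → ℝ => z ⟨[], rfl⟩ :=
      measurable_pi_apply _
    have hST : Disjoint ({[]}ᶜ : Set (List Bool)) {[]} := disjoint_compl_left
    exact (hind.indepFun_restrict hX hST).comp
      (φ := fun z => (subtreeConductance k (fun w => z ⟨false :: w, by simp⟩) +
        subtreeConductance k (fun w => z ⟨true :: w, by simp⟩)) / 2)
      (ψ := fun z => z ⟨[], rfl⟩)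
      (((mC.comp (measurable_pi_lambda _ fun w => measurable_pi_apply _)).add
        (mC.comp (measurable_pi_lambda _ fun w => measurable_pi_apply _))).div_const 2)
      mroot
  have key := series_parallel_mean_variance ha
    (by positivity : 0 < 1 / (b * ((k : ℝ) + 1))) (hX []) (mY false) (mY true) hindY hindX
    (hXab.mono fun ω hω => hω []) (ae_subtreeConductance_mem_Icc ha hab hXab _ k)
    (ae_subtreeConductance_mem_Icc ha hab hXab _ k) hμ hs
    (hdist false).integral_eq (hdist true).integral_eq
    (hdist false).variance_eq (hdist true).variance_eq
  have e : ∀ c : ℝ, c * (1 / (a * ((k : ℝ) + 1))) ^ 4 = c / (a * ((k : ℝ) + 1)) ^ 4 := by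
    intro c; rw [one_div, inv_pow, div_eq_mul_inv]
  rw [e, e] at key
  exact key

end IID

end ElectricNetwork

/-! ### Assembly of the two expansions. -/

open ElectricNetwork in
theorem theorem5 (a b : ℝ) (ha : 0 < a) (hab : a < b) :
    ∃ M₁ M₂ : ℝ, ∀ (Ω : Type*) [MeasurableSpace Ω] (P : Measure Ω) [IsProbabilityMeasure P]
      (X : List Bool → Ω → ℝ) (μ σ : ℝ),
      (∀ e, Measurable (X e)) →
      iIndepFun X P →
      (∀ e e', IdentDistrib (X e) (X e') P P) →
      (∀ e, ∀ᵐ ω ∂P, X e ω ∈ Set.Icc a b) →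
      (∀ e, ∫ ω, X e ω ∂P = μ) →
      (∀ e, Var[X e; P] = σ ^ 2) →
      ∀ n : ℕ, 2 ≤ n →
        (Integrable (fun ω => ElectricNetwork.treeEffectiveResistance n (fun e => X e ω)) P ∧
          |(∫ ω, ElectricNetwork.treeEffectiveResistance n (fun e => X e ω) ∂P)
            - μ * n + σ ^ 2 / μ * Real.log n| ≤ M₁) ∧
        (Integrable (fun ω => ElectricNetwork.treeConductance n (fun e => X e ω)) P ∧
          |(∫ ω, ElectricNetwork.treeConductance n (fun e => X e ω) ∂P)
            - 1 / (μ * n) - σ ^ 2 * Real.log n / (μ ^ 3 * n ^ 2)| ≤ M₂ / n ^ 2) := by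
  have hb : 0 < b := ha.trans hab
  obtain ⟨M, K, hM0, hK0, hMK⟩ := exists_bounds_of_recursion ha hab.le
  obtain ⟨M', hM'⟩ := exists_abs_one_div_sub_le ha hab.le hM0
  refine ⟨M + K * b ^ 3, M', ?_⟩
  intro Ω _ P _ X μ σ hX hind hid hXab' hμ hσ n hn
  have hXab : ∀ᵐ ω ∂P, ∀ e, X e ω ∈ Set.Icc a b := ae_all_iff.2 hXab'
  set Y : ℕ → Ω → ℝ := fun k ω => subtreeConductance k (fun w => X w ω) with hYdef
  have mY : ∀ k, Measurable (Y k) := fun k =>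
    (measurable_subtreeConductance k).comp (measurable_pi_lambda _ hX)
  have hY : ∀ k : ℕ, ∀ᵐ ω ∂P, Y k ω ∈
      Set.Icc (1 / (b * ((k : ℝ) + 1))) (1 / (a * ((k : ℝ) + 1))) :=
    fun k => ae_subtreeConductance_mem_Icc ha hab.le hXab id k
  have hμab : μ ∈ Set.Icc a b :=
    hμ [] ▸ integral_mem_Icc (hX []).aestronglyMeasurable (hXab' [])
  have hσb : σ ^ 2 ≤ b ^ 2 :=
    hσ [] ▸ variance_le_sq_of_mem_Icc ha.le (hX []).aestronglyMeasurable (hXab' [])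
  have hE : ∀ k : ℕ, ∫ ω, Y k ω ∂P ∈
      Set.Icc (1 / (b * ((k : ℝ) + 1))) (1 / (a * ((k : ℝ) + 1))) :=
    fun k => integral_mem_Icc (mY k).aestronglyMeasurable (hY k)
  have hstep := subtreeConductance_mean_variance_succ ha hab.le hX hind hid hXab (hμ []) (hσ [])
  obtain ⟨k, rfl⟩ : ∃ k, n = k + 1 := ⟨n - 1, by omega⟩
  obtain ⟨hVk, hek⟩ := hMK (fun k => ∫ ω, Y k ω ∂P) (fun k => Var[Y k; P]) μ (σ ^ 2) hμab.1 hμab.2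
    (sq_nonneg σ) hσb (fun k => (hE k).1) (fun k => (hE k).2)
    (fun k => variance_le_sq_of_mem_Icc (by positivity) (mY k).aestronglyMeasurable (hY k))
    (fun k => (hstep k).1) (fun k => (hstep k).2) k
  have hC : (fun ω => treeConductance (k + 1) (fun e => X e ω)) =ᵐ[P] Y k := by
    filter_upwards [hXab] with ω hω
    exact treeConductance_succ k fun w => ha.trans_le (hω w).1
  have hR : (fun ω => treeEffectiveResistance (k + 1) (fun e => X e ω)) =ᵐ[P]
      fun ω => 1 / Y k ω := by
    filter_upwards [hC] with ω hω
    rw [← hω]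
    rfl
  have hl : 0 < 1 / (b * ((k : ℝ) + 1)) := by positivity
  obtain ⟨iR, hRe⟩ := abs_integral_one_div_sub_le hl (mY k) (hY k)
  have iC := integrable_of_mem_Icc (mY k).aestronglyMeasurable (hY k)
  rw [integral_congr_ae hR, integral_congr_ae hC]
  have hN : 1 ≤ (k : ℝ) + 1 := by simp
  push_cast
  refine ⟨⟨iR.congr hR.symm, ?_⟩, iC.congr hC.symm, ?_⟩
  -- The cost of exchanging expectation and reciprocal: variance `O(N⁻⁴)` against `N³`, the source
  -- of `K * b ^ 3` in the constant.
  · have h1 : Var[Y k; P] / (1 / (b * ((k : ℝ) + 1))) ^ 3 ≤ K * b ^ 3 := by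
      calc _ ≤ K / ((k : ℝ) + 1) ^ 4 / (1 / (b * ((k : ℝ) + 1))) ^ 3 := by gcongr
        _ = K * b ^ 3 / ((k : ℝ) + 1) := by field_simp
        _ ≤ K * b ^ 3 := div_le_self (by positivity) hN
    have e : ∫ ω, 1 / Y k ω ∂P - μ * ((k : ℝ) + 1) + σ ^ 2 / μ * Real.log ((k : ℝ) + 1) =
        (1 / ∫ ω, Y k ω ∂P - μ * ((k : ℝ) + 1) + σ ^ 2 / μ * Real.log ((k : ℝ) + 1)) +
        (∫ ω, 1 / Y k ω ∂P - 1 / ∫ ω, Y k ω ∂P) := by ring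
    rw [e]
    exact (abs_add_le _ _).trans (add_le_add hek (hRe.trans h1))
  · have h0 : 0 < ∫ ω, Y k ω ∂P := hl.trans_le (hE k).1
    have hfl : a * ((k : ℝ) + 1) ≤ 1 / ∫ ω, Y k ω ∂P := by
      rw [le_one_div (by positivity) h0]
      exact (hE k).2
    have := hM' (1 / ∫ ω, Y k ω ∂P) μ (σ ^ 2) ((k : ℝ) + 1) hμab.1 (sq_nonneg σ) hσb hN hfl hek
    rwa [one_div_one_div] at this
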